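/- Let $\gamma,\lambda\in\mathbb R$ satisfy $\gamma<1$, $\gamma+\lambda<1$ and $\gamma+2\lambda\ge 0$. Let $K:(0,\infty)^2\to\mathbb R$ be continuous, symmetric ($K(x,y)=K(y,x)$), homogeneous of degree $\gamma$ ($K(ax,ay)=a^\gamma K(x,y)$ for all $a,x,y>0$), and such that for some constants $0<c_2\le c_1<\infty$ and all $x,y>0$ $$c_2\left[\frac{x^{\gamma+\lambda}}{y^{\lambda}}+\frac{y^{\gamma+\lambda}}{x^{\lambda}}\right]\le K(x,y)\le c_1\left[\frac{x^{\gamma+\lambda}}{y^{\lambda}}+\frac{y^{\gamma+\lambda}}{x^{\lambda}}\right].$$ When $\gamma+2\lambda\ge 1$, a *self-similar profile* with respect to $K$ is a non-negative Radon measure $\Phi$ on $(0,\infty)$ such that $$0<\int_{(0,\infty)}x^{\gamma+\lambda}\,\Phi(dx)<\infty,\qquad \int_{(0,1)}x^{1-\lambda}\,\Phi(dx)<\infty,$$ and such that for every $\varphi\in C^1_c((0,\infty))$ $$\int_{(0,\infty)}\varphi'(x)\left[\frac{2}{1-\gamma}x-\frac{x^{\gamma+\lambda}}{\int_{(0,\infty)}z^{\gamma+\lambda}\,\Phi(dz)}\right]\Phi(dx)-\frac{1+\gamma}{1-\gamma}\int_{(0,\infty)}\varphi(x)\,\Phi(dx)$$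 $$=\frac12\int_{(0,\infty)}\int_{(0,\infty)}K(x,y)\left[\varphi(x+y)-\varphi(x)-\varphi(y)\right]\Phi(dx)\,\Phi(dy).$$ Then the following hold. 1. If $\gamma\le-1$ and $\gamma+2\lambda>1$, then no self-similar profile with respect to $K$ exists. 2. If $\gamma\le-1$ and $\gamma+2\lambda=1$, then no self-similar profile $\Phi$ with respect to $K$ such that $\int_{(0,1]}x^{-\lambda}\,\Phi(dx)<\infty$ exists. -/

import Mathlib

open MeasureTheory

/-- The half-line `ℝ_* = (0, ∞)`. -/
abbrev PosReal : Type := Set.Ioi (0 : ℝ)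

/-- Homogeneous symmetric coagulation kernels of homogeneity `γ`, continuous on `(0, ∞)²` and
comparable to `x ^ (γ + lam) / y ^ lam + y ^ (γ + lam) / x ^ lam`. Only the values of `K` on
`(0, ∞)²` matter. -/
structure IsCoagulationKernel (K : ℝ → ℝ → ℝ) (γ lam : ℝ) : Prop where
  homogeneous : ∀ a x y : ℝ, 0 < a → 0 < x → 0 < y → K (a * x) (a * y) = a ^ γ * K x y
  symmetric : ∀ x y : ℝ, 0 < x → 0 < y → K x y = K y x
  continuousOn : ContinuousOn (fun p : ℝ × ℝ => K p.1 p.2) (Set.Ioi 0 ×ˢ Set.Ioi 0)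
  bounds : ∃ c₁ c₂ : ℝ, 0 < c₂ ∧ c₂ ≤ c₁ ∧ ∀ x y : ℝ, 0 < x → 0 < y →
    c₂ * (x ^ (γ + lam) / y ^ lam + y ^ (γ + lam) / x ^ lam) ≤ K x y ∧
    K x y ≤ c₁ * (x ^ (γ + lam) / y ^ lam + y ^ (γ + lam) / x ^ lam)
  exponents : 0 ≤ γ + 2 * lam

/-- The test functions `C¹_c(ℝ_*)`, extended by zero to `ℝ`. -/
structure IsTestFunction (φ : ℝ → ℝ) : Prop where
  contDiff : ContDiff ℝ 1 φ
  hasCompactSupport : HasCompactSupport φ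
  tsupport_subset : tsupport φ ⊆ Set.Ioi 0

/-- Self-similar profiles with respect to the kernel `K`: non-negative Radon measures `Φ` on
`(0, ∞)` with the two moment conditions which satisfy the weak form of the equation.
(A locally finite Borel measure on `(0, ∞)` is automatically Radon.) For such `Φ` all the
integrals in `weak_eq` converge absolutely. -/
structure IsSelfSimilarProfile (K : ℝ → ℝ → ℝ) (γ lam : ℝ) (Φ : Measure PosReal) : Prop where
  locallyFinite : IsLocallyFiniteMeasure Φ
  moment_pos : 0 < ∫⁻ x : PosReal, ENNReal.ofReal ((x : ℝ) ^ (γ + lam)) ∂Φ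
  moment_lt_top : ∫⁻ x : PosReal, ENNReal.ofReal ((x : ℝ) ^ (γ + lam)) ∂Φ < ⊤
  moment_near_zero_lt_top :
    ∫⁻ x in {x : PosReal | (x : ℝ) < 1}, ENNReal.ofReal ((x : ℝ) ^ (1 - lam)) ∂Φ < ⊤
  weak_eq : ∀ φ : ℝ → ℝ, IsTestFunction φ →
    (∫ x : PosReal, deriv φ x *
        (2 / (1 - γ) * (x : ℝ)
          - (x : ℝ) ^ (γ + lam) / ∫ z : PosReal, (z : ℝ) ^ (γ + lam) ∂Φ) ∂Φ)
      - (1 + γ) / (1 - γ) * ∫ x : PosReal, φ x ∂Φ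
    = 1 / 2 * ∫ x : PosReal, ∫ y : PosReal,
        K x y * (φ ((x : ℝ) + (y : ℝ)) - φ x - φ y) ∂Φ ∂Φ

/-! Suppose a profile exists and test its equation with φ(x) = x/(x+ε) · (1+x)^m, where m = min(γ+λ,
0). Letting ε → 0 turns φ into the subadditive power (1+x)^m. Three facts collide.

Transport: `x φ' ≥ m φ`, and 2m ≥ 1+γ because γ ≤ -1 and γ+2λ ≥ 1. Hence the scaling terms are
nonnegative, and the left side is at least -M⁻¹ ∫ φ' x^(γ+λ), where φ' ≤ ε/(x+ε)². This last
integral is the flux into the origin.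

Coagulation: quantified subadditivity bounds the loss below by a product integral. Together these
give c ∫ `lossDensity` ≤ ∫ `fluxDensity` with c independent of ε
(`exists_mul_integral_lossDensity_le`). The loss increases as ε decreases, so the flux stays away
from 0.

Smallness: if γ+2λ > 1, the flux density near 0 is at most c/2 times the loss density, so it is
absorbed and the flux is O(ε). If γ+2λ = 1, the extra moment allows dominated convergence. Either
way the flux tends to 0, a contradiction.

Since φ lacks compact support, the weak formulation is first extended to such functions by cutoffs
(`IsSelfSimilarProfile.weak_eq_of_isAdmissible`). -/

open Set Filter Topology

/-! ### Moment weights and integrability -/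

/-- Weight dominating all integrands of the weak formulation, for exponents `b` at infinity and
`1 - lam` at zero. -/
noncomputable def momentWeight (b lam x : ℝ) : ℝ :=
  x ^ b + if x < 1 then x ^ (1 - lam) else 0

lemma rpow_le_momentWeight {b lam x : ℝ} (hx : 0 < x) : x ^ b ≤ momentWeight b lam x := by
  unfold momentWeight
  split_ifs
  · linarith [Real.rpow_pos_of_pos hx (1 - lam)]
  · simp

lemma momentWeight_pos {b lam x : ℝ} (hx : 0 < x) : 0 < momentWeight b lam x :=
  (Real.rpow_pos_of_pos hx b).trans_le (rpow_le_momentWeight hx)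

lemma rpow_le_momentWeight_of_lt_one {b lam x : ℝ} (hx : 0 < x) (hx1 : x < 1) :
    x ^ (1 - lam) ≤ momentWeight b lam x := by
  unfold momentWeight
  rw [if_pos hx1]
  linarith [Real.rpow_pos_of_pos hx b]

lemma min_one_mul_rpow_neg_le_momentWeight {b lam x : ℝ} (hb : 0 ≤ b + lam) (hx : 0 < x) :
    min 1 x * x ^ (-lam) ≤ momentWeight b lam x := by
  rcases lt_or_ge x 1 with h | h
  · rw [min_eq_right h.le]
    refine le_trans (le_of_eq ?_) (rpow_le_momentWeight_of_lt_one hx h)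
    rw [sub_eq_add_neg, Real.rpow_add hx, Real.rpow_one]
  · rw [min_eq_left h, one_mul]
    exact (Real.rpow_le_rpow_of_exponent_le h (by linarith)).trans (rpow_le_momentWeight hx)

/-- For x < 1 the linear bound suffices, as x ≤ 1 ≤ x^(1-λ) when λ ≥ 1; for x ≥ 1 the power bound
does. -/
lemma le_momentWeight_of_le {b lam m A x t : ℝ} (hlam : 1 ≤ lam) (hmb : m ≤ b) (hA : 0 ≤ A)
    (hx : 0 < x) (h₁ : t ≤ A * x) (h₂ : t ≤ A * x ^ m) : t ≤ A * momentWeight b lam x := by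
  rcases lt_or_ge x 1 with h | h
  · refine h₁.trans (mul_le_mul_of_nonneg_left ?_ hA)
    have := Real.one_le_rpow_of_pos_of_le_one_of_nonpos hx h.le (z := 1 - lam) (by linarith)
    linarith [rpow_le_momentWeight_of_lt_one (b := b) (lam := lam) hx h]
  · exact h₂.trans (mul_le_mul_of_nonneg_left
      ((Real.rpow_le_rpow_of_exponent_le h hmb).trans (rpow_le_momentWeight hx)) hA)

lemma integrable_rpow_of_lintegral_lt_top {μ : Measure PosReal} {b : ℝ}
    (h : ∫⁻ x : PosReal, ENNReal.ofReal ((x : ℝ) ^ b) ∂μ < ⊤) :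
    Integrable (fun x : PosReal => (x : ℝ) ^ b) μ :=
  ⟨(measurable_subtype_coe.pow_const b).aestronglyMeasurable,
    (hasFiniteIntegral_iff_ofReal
      (ae_of_all _ fun x : PosReal => Real.rpow_nonneg (le_of_lt x.2) _)).2 h⟩

lemma integrable_ite_rpow {μ : Measure PosReal} {b : ℝ} {p : ℝ → Prop} [DecidablePred p]
    (hp : MeasurableSet {x : PosReal | p x})
    (h : ∫⁻ x in {x : PosReal | p x}, ENNReal.ofReal ((x : ℝ) ^ b) ∂μ < ⊤) :
    Integrable (fun x : PosReal => if p x then (x : ℝ) ^ b else 0) μ := by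
  have h1 := (integrable_indicator_iff hp).2 (integrable_rpow_of_lintegral_lt_top h)
  refine h1.congr (ae_of_all _ fun x => ?_)
  simp [Set.indicator_apply]

lemma IsSelfSimilarProfile.integrable_rpow {K : ℝ → ℝ → ℝ} {γ lam : ℝ} {Φ : Measure PosReal}
    (h : IsSelfSimilarProfile K γ lam Φ) :
    Integrable (fun x : PosReal => (x : ℝ) ^ (γ + lam)) Φ :=
  integrable_rpow_of_lintegral_lt_top h.moment_lt_top

lemma IsSelfSimilarProfile.integrable_momentWeight {K : ℝ → ℝ → ℝ} {γ lam : ℝ}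
    {Φ : Measure PosReal} (h : IsSelfSimilarProfile K γ lam Φ) :
    Integrable (fun x : PosReal => momentWeight (γ + lam) lam x) Φ :=
  h.integrable_rpow.add (integrable_ite_rpow (p := fun x => x < 1)
    (measurableSet_lt measurable_subtype_coe measurable_const) h.moment_near_zero_lt_top)

lemma IsSelfSimilarProfile.ne_zero {K : ℝ → ℝ → ℝ} {γ lam : ℝ} {Φ : Measure PosReal}
    (h : IsSelfSimilarProfile K γ lam Φ) : Φ ≠ 0 := by
  rintro rfl
  simpa using h.moment_pos

lemma integral_pos_of_pos {α : Type*} [MeasurableSpace α] {μ : Measure α} (hμ : μ ≠ 0)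
    {f : α → ℝ} (hf : Integrable f μ) (hpos : ∀ x, 0 < f x) : 0 < ∫ x, f x ∂μ := by
  rw [integral_pos_iff_support_of_nonneg (fun x => (hpos x).le) hf]
  have : Function.support f = univ := by
    ext x
    simp [(hpos x).ne']
  rw [this]
  exact pos_iff_ne_zero.2 (by simpa using hμ)

/-! ### Admissible test functions and the coagulation integrand -/

/-- Functions that can be inserted into the weak formulation by approximation: together with
`x φ'(x)` they are bounded by a multiple of `min x (x ^ m)`. -/
structure IsAdmissible (φ : ℝ → ℝ) (m A : ℝ) : Prop where
  contDiffOn : ContDiffOn ℝ 1 φ (Ioi 0)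
  abs_le_mul : ∀ x, 0 < x → |φ x| ≤ A * x
  abs_le_rpow : ∀ x, 0 < x → |φ x| ≤ A * x ^ m
  deriv_le_mul : ∀ x, 0 < x → |x * deriv φ x| ≤ A * x
  deriv_le_rpow : ∀ x, 0 < x → |x * deriv φ x| ≤ A * x ^ m

/-- The increment of `φ` in a coagulation event. -/
def coagIncrement (φ : ℝ → ℝ) (x y : ℝ) : ℝ := φ (x + y) - φ x - φ y

lemma coagIncrement_comm (φ : ℝ → ℝ) (x y : ℝ) : coagIncrement φ x y = coagIncrement φ y x := by
  unfold coagIncrement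
  rw [add_comm]
  ring

namespace IsAdmissible

variable {φ : ℝ → ℝ} {m A : ℝ}

lemma nonneg (h : IsAdmissible φ m A) : 0 ≤ A := by
  have := h.abs_le_mul 1 one_pos
  linarith [abs_nonneg (φ 1)]

lemma differentiableAt (h : IsAdmissible φ m A) {x : ℝ} (hx : 0 < x) : DifferentiableAt ℝ φ x :=
  (h.contDiffOn.differentiableOn one_ne_zero).differentiableAt (Ioi_mem_nhds hx)

lemma abs_deriv_le (h : IsAdmissible φ m A) {x : ℝ} (hx : 0 < x) : |deriv φ x| ≤ A := by
  have := h.deriv_le_mul x hx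
  rw [abs_mul, abs_of_pos hx, mul_comm] at this
  exact le_of_mul_le_mul_right this hx

lemma abs_le (h : IsAdmissible φ m A) (hm : m ≤ 0) {x : ℝ} (hx : 0 < x) : |φ x| ≤ A := by
  rcases le_total x 1 with h1 | h1
  · exact (h.abs_le_mul x hx).trans (by nlinarith [h.nonneg])
  · exact (h.abs_le_rpow x hx).trans
      (mul_le_of_le_one_right h.nonneg (Real.rpow_le_one_of_one_le_of_nonpos h1 hm))

lemma abs_sub_le (h : IsAdmissible φ m A) {x y : ℝ} (hx : 0 < x) (hy : 0 < y) :
    |φ (x + y) - φ y| ≤ A * x := by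
  have := (convex_Ioi (0 : ℝ)).norm_image_sub_le_of_norm_deriv_le (f := φ) (C := A)
    (fun z hz => h.differentiableAt hz) (fun z hz => h.abs_deriv_le hz)
    (x := y) (y := x + y) hy (add_pos hx hy)
  simpa [Real.norm_eq_abs, abs_of_pos hx] using this

/-- For small x the mean value theorem makes the increment O(x), which compensates the singularity
x^(-λ) of the kernel; for large x each of the three terms is at most A. -/
lemma abs_coagIncrement_le (h : IsAdmissible φ m A) (hm : m ≤ 0) {x y : ℝ} (hx : 0 < x)
    (hy : 0 < y) : |coagIncrement φ x y| ≤ 3 * A * min 1 x := by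
  have hA := h.nonneg
  unfold coagIncrement
  rcases le_total x 1 with h1 | h1
  · rw [min_eq_right h1]
    have e1 := h.abs_sub_le hx hy
    have e2 := h.abs_le_mul x hx
    have e3 := abs_sub (φ (x + y) - φ y) (φ x)
    rw [show φ (x + y) - φ x - φ y = φ (x + y) - φ y - φ x by ring]
    nlinarith
  · rw [min_eq_left h1]
    have e1 := h.abs_le hm (add_pos hx hy)
    have e2 := h.abs_le hm hx
    have e3 := h.abs_le hm hy
    have e4 := abs_sub (φ (x + y) - φ x) (φ y)
    have e5 := abs_sub (φ (x + y)) (φ x)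
    linarith

end IsAdmissible

lemma rpow_div_le_of_le {γ lam x y : ℝ} (hs : 0 ≤ γ + 2 * lam) (hx : 0 < x) (hxy : x ≤ y) :
    x ^ (γ + lam) / y ^ lam ≤ y ^ (γ + lam) / x ^ lam := by
  have hy := hx.trans_le hxy
  rw [div_le_div_iff₀ (Real.rpow_pos_of_pos hy _) (Real.rpow_pos_of_pos hx _),
    ← Real.rpow_add hx, ← Real.rpow_add hy]
  exact Real.rpow_le_rpow hx.le hxy (by linarith)

/-- The constant depends on φ only through A, so a whole sequence of truncations shares one
integrable majorant. By symmetry x ≤ y may be assumed, where the singular term y^(γ+λ)/x^λ dominates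
the kernel. -/
lemma IsCoagulationKernel.exists_bound {K : ℝ → ℝ → ℝ} {γ lam : ℝ}
    (hK : IsCoagulationKernel K γ lam) {m A : ℝ} (hm : m ≤ 0) (hA : 0 ≤ A) :
    ∃ C : ℝ, ∀ φ : ℝ → ℝ, IsAdmissible φ m A → ∀ x y : ℝ, 0 < x → 0 < y →
      |K x y * coagIncrement φ x y| ≤
        C * (momentWeight (γ + lam) lam x * momentWeight (γ + lam) lam y) := by
  obtain ⟨c₁, c₂, hc₂, hc, hb⟩ := hK.bounds
  have hc₁ : 0 < c₁ := hc₂.trans_le hc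
  have hs := hK.exponents
  refine ⟨6 * c₁ * A, fun φ hφ => ?_⟩
  have key : ∀ x y : ℝ, 0 < x → x ≤ y → |K x y * coagIncrement φ x y| ≤
      6 * c₁ * A * (momentWeight (γ + lam) lam x * momentWeight (γ + lam) lam y) := by
    intro x y hx hxy
    have hy := hx.trans_le hxy
    have hKle : |K x y| ≤ 2 * c₁ * (x ^ (-lam) * y ^ (γ + lam)) := by
      have hpos : 0 ≤ x ^ (γ + lam) / y ^ lam + y ^ (γ + lam) / x ^ lam := by positivity
      rw [abs_of_nonneg ((mul_nonneg hc₂.le hpos).trans (hb x y hx hy).1)]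
      refine (hb x y hx hy).2.trans ?_
      have := rpow_div_le_of_le hs hx hxy
      rw [Real.rpow_neg hx.le, ← div_eq_inv_mul]
      nlinarith
    rw [abs_mul]
    calc |K x y| * |coagIncrement φ x y|
        ≤ (2 * c₁ * (x ^ (-lam) * y ^ (γ + lam))) * (3 * A * min 1 x) := by
          gcongr
          exact hφ.abs_coagIncrement_le hm hx hy
      _ = 6 * c₁ * A * ((min 1 x * x ^ (-lam)) * y ^ (γ + lam)) := by ring
      _ ≤ _ := by
          have hw := momentWeight_pos (b := γ + lam) (lam := lam) hx
          gcongr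
          · exact min_one_mul_rpow_neg_le_momentWeight (by linarith) hx
          · exact rpow_le_momentWeight hy
  intro x y hx hy
  rcases le_total x y with h | h
  · exact key x y hx h
  · rw [hK.symmetric x y hx hy, coagIncrement_comm, mul_comm (momentWeight _ _ x)]
    exact key y x hy h

/-! ### Cutoffs -/

/-- A smooth step from `0` on `(-∞, 1]` to `1` on `[2, ∞)`. -/
noncomputable def smoothStep (t : ℝ) : ℝ := Real.smoothTransition (t - 1)

lemma contDiff_smoothStep : ContDiff ℝ 1 smoothStep :=
  (Real.smoothTransition.contDiff (n := 1)).comp (contDiff_id.sub contDiff_const)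

lemma smoothStep_of_le_one {t : ℝ} (h : t ≤ 1) : smoothStep t = 0 :=
  Real.smoothTransition.zero_of_nonpos (by linarith)

lemma smoothStep_of_two_le {t : ℝ} (h : 2 ≤ t) : smoothStep t = 1 :=
  Real.smoothTransition.one_of_one_le (by linarith)

lemma smoothStep_nonneg (t : ℝ) : 0 ≤ smoothStep t := Real.smoothTransition.nonneg _

lemma smoothStep_le_one (t : ℝ) : smoothStep t ≤ 1 := Real.smoothTransition.le_one _

lemma exists_abs_mul_deriv_smoothStep_le : ∃ B : ℝ, ∀ t, |t * deriv smoothStep t| ≤ B := by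
  have hc : Continuous fun t => t * deriv smoothStep t :=
    continuous_id.mul (contDiff_smoothStep.continuous_deriv le_rfl)
  obtain ⟨B, hB⟩ := (isCompact_Icc (a := (1 : ℝ)) (b := 2)).exists_bound_of_continuousOn
    hc.continuousOn
  refine ⟨B, fun t => ?_⟩
  have hB0 : 0 ≤ B := (norm_nonneg _).trans (hB 1 (by norm_num))
  by_cases ht : t ∈ Icc (1 : ℝ) 2
  · exact hB t ht
  · have hd : deriv smoothStep t = 0 := by
      rw [mem_Icc, not_and_or, not_le, not_le] at ht
      rcases ht with h | h
      · have : smoothStep =ᶠ[𝓝 t] fun _ => 0 := by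
          filter_upwards [Iio_mem_nhds h] with u hu using smoothStep_of_le_one (le_of_lt hu)
        rw [this.deriv_eq, deriv_const]
      · have : smoothStep =ᶠ[𝓝 t] fun _ => 1 := by
          filter_upwards [Ioi_mem_nhds h] with u hu using smoothStep_of_two_le (le_of_lt hu)
        rw [this.deriv_eq, deriv_const]
    simpa [hd] using hB0

/-- A smooth cutoff, supported in `[1 / N, 2 * N]` and equal to `1` on `[2 / N, N]`. -/
noncomputable def cutoff (N x : ℝ) : ℝ := smoothStep (N * x) * (1 - smoothStep (N⁻¹ * x))

lemma contDiff_cutoff (N : ℝ) : ContDiff ℝ 1 (cutoff N) :=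
  (contDiff_smoothStep.comp (contDiff_const.mul contDiff_id)).mul
    (contDiff_const.sub (contDiff_smoothStep.comp (contDiff_const.mul contDiff_id)))

lemma abs_cutoff_le (N x : ℝ) : |cutoff N x| ≤ 1 := by
  have h1 := smoothStep_nonneg (N * x)
  have h2 := smoothStep_le_one (N * x)
  have h3 := smoothStep_nonneg (N⁻¹ * x)
  have h4 := smoothStep_le_one (N⁻¹ * x)
  unfold cutoff
  rw [abs_of_nonneg (mul_nonneg h1 (by linarith))]
  nlinarith

lemma abs_mul_deriv_cutoff_le {B : ℝ} (hB : ∀ t, |t * deriv smoothStep t| ≤ B) (N x : ℝ) :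
    |x * deriv (cutoff N) x| ≤ 2 * B := by
  have hd (t : ℝ) : HasDerivAt smoothStep (deriv smoothStep t) t :=
    (contDiff_smoothStep.differentiable one_ne_zero t).hasDerivAt
  have hl (c : ℝ) : HasDerivAt (fun x => c * x) c x := by simpa using (hasDerivAt_id x).const_mul c
  have h1 := (hd (N * x)).comp x (hl N)
  have h2 := (hd (N⁻¹ * x)).comp x (hl N⁻¹)
  have h3 : deriv (cutoff N) x = _ := (h1.mul (h2.const_sub 1)).deriv
  rw [h3]
  simp only [Function.comp_apply]
  set a := smoothStep (N * x)
  set c := smoothStep (N⁻¹ * x)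
  have e1 : 0 ≤ a := smoothStep_nonneg _
  have e2 : a ≤ 1 := smoothStep_le_one _
  have e3 : 0 ≤ c := smoothStep_nonneg _
  have e4 : c ≤ 1 := smoothStep_le_one _
  set p := N * x * deriv smoothStep (N * x)
  set q := N⁻¹ * x * deriv smoothStep (N⁻¹ * x)
  have hp : |p| ≤ B := hB (N * x)
  have hq : |q| ≤ B := hB (N⁻¹ * x)
  have e : x * (deriv smoothStep (N * x) * N * (1 - c) +
      a * -(deriv smoothStep (N⁻¹ * x) * N⁻¹)) = p * (1 - c) - a * q := by ring
  rw [e]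
  calc |p * (1 - c) - a * q| ≤ |p * (1 - c)| + |a * q| := abs_sub _ _
    _ = |p| * (1 - c) + a * |q| := by
        rw [abs_mul p, abs_mul a, abs_of_nonneg e1, abs_of_nonneg (by linarith : 0 ≤ 1 - c)]
    _ ≤ 2 * B := by nlinarith [abs_nonneg p, abs_nonneg q]

lemma cutoff_eq_zero {N x : ℝ} (hN : 0 < N) (h : x ∉ Icc N⁻¹ (2 * N)) : cutoff N x = 0 := by
  rw [mem_Icc, not_and_or, not_le, not_le] at h
  unfold cutoff
  rcases h with h | h
  · rw [smoothStep_of_le_one, zero_mul]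
    exact ((lt_inv_mul_iff₀ hN).1 (by simpa using h)).le
  · rw [smoothStep_of_two_le (t := N⁻¹ * x), sub_self, mul_zero]
    rw [le_inv_mul_iff₀ hN]
    linarith

lemma cutoff_eventuallyEq_one {x : ℝ} (hx : 0 < x) :
    ∀ᶠ n : ℕ in atTop, cutoff ((n : ℝ) + 1) =ᶠ[𝓝 x] fun _ => 1 := by
  have hn : Tendsto (fun n : ℕ => (n : ℝ) + 1) atTop atTop :=
    tendsto_natCast_atTop_atTop.atTop_add tendsto_const_nhds
  filter_upwards [hn.eventually_gt_atTop (2 * x), hn.eventually_gt_atTop (4 / x)] with n h1 h2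
  have hN : (0 : ℝ) < (n : ℝ) + 1 := by positivity
  filter_upwards [Ioo_mem_nhds (show x / 2 < x by linarith) (show x < 2 * x by linarith)]
    with u hu
  have hux : 2 ≤ ((n : ℝ) + 1) * u := by
    have : 4 < ((n : ℝ) + 1) * x := (div_lt_iff₀ hx).1 h2
    nlinarith [hu.1]
  unfold cutoff
  rw [smoothStep_of_two_le hux, smoothStep_of_le_one (t := _ * u)]
  · simp
  · rw [inv_mul_le_iff₀ hN]
    linarith [hu.2]

lemma IsAdmissible.isTestFunction_mul_cutoff {φ : ℝ → ℝ} {m A : ℝ} (h : IsAdmissible φ m A)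
    {N : ℝ} (hN : 0 < N) : IsTestFunction fun x => φ x * cutoff N x := by
  have hz : ∀ x, x ∉ Icc N⁻¹ (2 * N) → φ x * cutoff N x = 0 := fun x hx => by
    rw [cutoff_eq_zero hN hx, mul_zero]
  refine ⟨contDiff_iff_contDiffAt.2 fun x => ?_, HasCompactSupport.intro isCompact_Icc hz, ?_⟩
  · rcases lt_or_ge 0 x with hx | hx
    · exact (h.contDiffOn.contDiffAt (Ioi_mem_nhds hx)).mul (contDiff_cutoff N).contDiffAt
    · refine (contDiffAt_const (c := (0 : ℝ))).congr_of_eventuallyEq ?_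
      filter_upwards [Iio_mem_nhds (hx.trans_lt (inv_pos.2 hN))] with u hu
      exact hz u fun hu' => absurd hu'.1 (not_le.2 hu)
  · refine (closure_minimal (t := Icc N⁻¹ (2 * N)) (fun x hx => ?_) isClosed_Icc).trans
      fun x hx => (inv_pos.2 hN).trans_le hx.1
    by_contra hx'
    exact hx (hz x hx')

/-- The operator x d/dx is scale invariant, so rescaling the cutoff costs a factor independent of
`N`. -/
lemma IsAdmissible.mul_cutoff {φ : ℝ → ℝ} {m A B : ℝ} (h : IsAdmissible φ m A)
    (hB : ∀ t, |t * deriv smoothStep t| ≤ B) (N : ℝ) :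
    IsAdmissible (fun x => φ x * cutoff N x) m (A * (1 + 2 * B)) := by
  have hA := h.nonneg
  have hB0 : 0 ≤ B := (abs_nonneg _).trans (hB 0)
  have main : ∀ x D, 0 < x → |φ x| ≤ A * D → |x * deriv φ x| ≤ A * D → 0 ≤ D →
      |φ x * cutoff N x| ≤ A * (1 + 2 * B) * D ∧
      |x * deriv (fun x => φ x * cutoff N x) x| ≤ A * (1 + 2 * B) * D := by
    intro x D hx h1 h2 hD
    have hc := abs_cutoff_le N x
    have hc' := abs_mul_deriv_cutoff_le hB N x
    have hAD : 0 ≤ A * D := mul_nonneg hA hD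
    constructor
    · rw [abs_mul]
      calc |φ x| * |cutoff N x| ≤ A * D * 1 := by gcongr
        _ ≤ _ := by nlinarith
    · have hd : deriv (fun x => φ x * cutoff N x) x = _ :=
        ((h.differentiableAt hx).hasDerivAt.mul
          ((contDiff_cutoff N).differentiable one_ne_zero x).hasDerivAt).deriv
      rw [hd, show x * (deriv φ x * cutoff N x + φ x * deriv (cutoff N) x) =
        x * deriv φ x * cutoff N x + φ x * (x * deriv (cutoff N) x) by ring]
      refine (abs_add_le _ _).trans ?_
      rw [abs_mul, abs_mul (φ x)]
      calc |x * deriv φ x| * |cutoff N x| + |φ x| * |x * deriv (cutoff N) x|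
          ≤ A * D * 1 + A * D * (2 * B) := by gcongr
        _ = _ := by ring
  have hr (x : ℝ) (hx : 0 < x) := (Real.rpow_pos_of_pos hx m).le
  exact ⟨h.contDiffOn.mul (contDiff_cutoff N).contDiffOn,
    fun x hx => (main x x hx (h.abs_le_mul x hx) (h.deriv_le_mul x hx) hx.le).1,
    fun x hx => (main x _ hx (h.abs_le_rpow x hx) (h.deriv_le_rpow x hx) (hr x hx)).1,
    fun x hx => (main x x hx (h.abs_le_mul x hx) (h.deriv_le_mul x hx) hx.le).2,
    fun x hx => (main x _ hx (h.abs_le_rpow x hx) (h.deriv_le_rpow x hx) (hr x hx)).2⟩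

lemma mul_cutoff_eventuallyEq (φ : ℝ → ℝ) {x : ℝ} (hx : 0 < x) :
    ∀ᶠ n : ℕ in atTop, (fun x => φ x * cutoff ((n : ℝ) + 1) x) =ᶠ[𝓝 x] φ := by
  filter_upwards [cutoff_eventuallyEq_one hx] with n hn
  filter_upwards [hn] with u hu
  rw [hu, mul_one]

/-! ### Extending the weak formulation to admissible functions -/

section Integrability

variable {K : ℝ → ℝ → ℝ} {γ lam m A : ℝ} {Φ : Measure PosReal} {φ : ℝ → ℝ}

/-- The transport velocity in the weak formulation. -/
noncomputable def driftCoeff (γ b M x : ℝ) : ℝ := 2 / (1 - γ) * x - x ^ b / M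

lemma IsAdmissible.continuous_subtype (h : IsAdmissible φ m A) :
    Continuous fun x : PosReal => φ x :=
  continuousOn_iff_continuous_domRestrict.1 h.contDiffOn.continuousOn

lemma IsAdmissible.aestronglyMeasurable_coag (h : IsAdmissible φ m A)
    (hK : IsCoagulationKernel K γ lam) (ν : Measure (PosReal × PosReal)) :
    AEStronglyMeasurable (fun p : PosReal × PosReal => K p.1 p.2 * coagIncrement φ p.1 p.2) ν := by
  have h1 : Continuous fun p : PosReal × PosReal => K p.1 p.2 :=
    hK.continuousOn.comp_continuous (f := fun p : PosReal × PosReal => ((p.1 : ℝ), (p.2 : ℝ)))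
      (by fun_prop) fun p => ⟨p.1.2, p.2.2⟩
  have h2 : Continuous fun p : PosReal × PosReal => φ ((p.1 : ℝ) + (p.2 : ℝ)) :=
    h.contDiffOn.continuousOn.comp_continuous (by fun_prop) fun p =>
      mem_Ioi.2 (add_pos p.1.2 p.2.2)
  have h3 := h.continuous_subtype
  exact (h1.mul ((h2.sub (h3.comp continuous_fst)).sub (h3.comp continuous_snd))).measurable
    |>.aestronglyMeasurable

lemma aestronglyMeasurable_deriv_mul_driftCoeff (φ : ℝ → ℝ) (γ b M : ℝ) :
    AEStronglyMeasurable (fun x : PosReal => deriv φ x * driftCoeff γ b M x) Φ := by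
  have h1 : Measurable fun x : PosReal => deriv φ x :=
    (measurable_deriv φ).comp measurable_subtype_coe
  have h2 : Measurable fun x : PosReal => driftCoeff γ b M x :=
    (measurable_subtype_coe.const_mul _).sub ((measurable_subtype_coe.pow_const b).div_const M)
  exact (h1.mul h2).aestronglyMeasurable

lemma IsAdmissible.abs_le_momentWeight (h : IsAdmissible φ m A) (hlam : 1 ≤ lam) {b : ℝ}
    (hmb : m ≤ b) {x : ℝ} (hx : 0 < x) : |φ x| ≤ A * momentWeight b lam x :=
  le_momentWeight_of_le hlam hmb h.nonneg hx (h.abs_le_mul x hx) (h.abs_le_rpow x hx)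

lemma IsAdmissible.abs_drift_le (h : IsAdmissible φ m A) (hlam : 1 ≤ lam) (hγ : γ < 1) {b M : ℝ}
    (hM : 0 < M) (hmb : m ≤ b) {x : ℝ} (hx : 0 < x) :
    |deriv φ x * driftCoeff γ b M x| ≤ (2 / (1 - γ) + 1 / M) * A * momentWeight b lam x := by
  have h1 := le_momentWeight_of_le (b := b) hlam hmb h.nonneg hx (h.deriv_le_mul x hx)
    (h.deriv_le_rpow x hx)
  have h2 := h.abs_deriv_le hx
  have h3 := rpow_le_momentWeight (b := b) (lam := lam) hx
  have hg : 0 < 1 - γ := by linarith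
  have hA := h.nonneg
  have hr := Real.rpow_pos_of_pos hx b
  unfold driftCoeff
  rw [show deriv φ x * (2 / (1 - γ) * x - x ^ b / M) =
    2 / (1 - γ) * (x * deriv φ x) - 1 / M * (deriv φ x * x ^ b) by ring]
  refine (abs_sub _ _).trans ?_
  rw [abs_mul, abs_mul (1 / M), abs_mul (deriv φ x), abs_of_pos hr,
    abs_of_pos (show 0 < 2 / (1 - γ) by positivity), abs_of_pos (show 0 < 1 / M by positivity)]
  calc 2 / (1 - γ) * |x * deriv φ x| + 1 / M * (|deriv φ x| * x ^ b)
      ≤ 2 / (1 - γ) * (A * momentWeight b lam x) + 1 / M * (A * momentWeight b lam x) := by gcongr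
    _ = _ := by ring

lemma IsSelfSimilarProfile.moment_integral_pos (hΦ : IsSelfSimilarProfile K γ lam Φ) :
    0 < ∫ z : PosReal, (z : ℝ) ^ (γ + lam) ∂Φ :=
  integral_pos_of_pos hΦ.ne_zero hΦ.integrable_rpow fun x => Real.rpow_pos_of_pos x.2 _

lemma IsAdmissible.integrable (h : IsAdmissible φ m A) (hΦ : IsSelfSimilarProfile K γ lam Φ)
    (hlam : 1 ≤ lam) (hmb : m ≤ γ + lam) : Integrable (fun x : PosReal => φ x) Φ :=
  (hΦ.integrable_momentWeight.const_mul A).mono' h.continuous_subtype.measurable.aestronglyMeasurable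
    (ae_of_all _ fun x => h.abs_le_momentWeight hlam hmb x.2)

lemma IsAdmissible.integrable_drift (h : IsAdmissible φ m A)
    (hΦ : IsSelfSimilarProfile K γ lam Φ) (hlam : 1 ≤ lam) (hγ : γ < 1) {M : ℝ} (hM : 0 < M)
    (hmb : m ≤ γ + lam) :
    Integrable (fun x : PosReal => deriv φ x * driftCoeff γ (γ + lam) M x) Φ :=
  (hΦ.integrable_momentWeight.const_mul _).mono'
    (aestronglyMeasurable_deriv_mul_driftCoeff φ γ _ M)
    (ae_of_all _ fun x => h.abs_drift_le hlam hγ hM hmb x.2)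

lemma IsAdmissible.integrable_coag [SFinite Φ] (h : IsAdmissible φ m A)
    (hK : IsCoagulationKernel K γ lam) (hΦ : IsSelfSimilarProfile K γ lam Φ) (hm : m ≤ 0) :
    Integrable (fun p : PosReal × PosReal => K p.1 p.2 * coagIncrement φ p.1 p.2) (Φ.prod Φ) := by
  obtain ⟨C, hC⟩ := hK.exists_bound hm h.nonneg
  exact ((hΦ.integrable_momentWeight.mul_prod hΦ.integrable_momentWeight).const_mul C).mono'
    (h.aestronglyMeasurable_coag hK _) (ae_of_all _ fun p => hC φ h p.1 p.2 p.1.2 p.2.2)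

/-- The weak formulation holds for all admissible functions. -/
theorem IsSelfSimilarProfile.weak_eq_of_isAdmissible [SFinite Φ]
    (hΦ : IsSelfSimilarProfile K γ lam Φ) (hK : IsCoagulationKernel K γ lam) (hγ : γ < 1)
    (hlam : 1 ≤ lam) (hm : m ≤ 0) (hmb : m ≤ γ + lam) (h : IsAdmissible φ m A) :
    (∫ x : PosReal, deriv φ x *
        driftCoeff γ (γ + lam) (∫ z : PosReal, (z : ℝ) ^ (γ + lam) ∂Φ) x ∂Φ)
      - (1 + γ) / (1 - γ) * ∫ x : PosReal, φ x ∂Φ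
    = 1 / 2 * ∫ p : PosReal × PosReal, K p.1 p.2 * coagIncrement φ p.1 p.2 ∂(Φ.prod Φ) := by
  obtain ⟨B, hB⟩ := exists_abs_mul_deriv_smoothStep_le
  set M := ∫ z : PosReal, (z : ℝ) ^ (γ + lam) ∂Φ with hMdef
  have hM : 0 < M := hΦ.moment_integral_pos
  set ψ : ℕ → ℝ → ℝ := fun n x => φ x * cutoff ((n : ℝ) + 1) x with hψ
  have hadm (n : ℕ) : IsAdmissible (ψ n) m (A * (1 + 2 * B)) := h.mul_cutoff hB _
  have hev {x : ℝ} (hx : 0 < x) : ∀ᶠ n in atTop, ψ n =ᶠ[𝓝 x] φ := mul_cutoff_eventuallyEq φ hx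
  -- All `ψ n` are admissible with the same constant; index 0 serves only to see that it is
  -- nonnegative.
  obtain ⟨C, hC⟩ := hK.exists_bound hm (hadm 0).nonneg
  have hpt {x : ℝ} (hx : 0 < x) : Tendsto (fun n => ψ n x) atTop (𝓝 (φ x)) :=
    tendsto_const_nhds.congr' ((hev hx).mono fun n hn => hn.eq_of_nhds.symm)
  have t1 : Tendsto (fun n => ∫ x : PosReal, deriv (ψ n) x * driftCoeff γ (γ + lam) M x ∂Φ) atTop
      (𝓝 (∫ x : PosReal, deriv φ x * driftCoeff γ (γ + lam) M x ∂Φ)) := by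
    refine tendsto_integral_of_dominated_convergence _
      (fun n => aestronglyMeasurable_deriv_mul_driftCoeff (ψ n) γ _ M)
      (hΦ.integrable_momentWeight.const_mul _)
      (fun n => ae_of_all _ fun x => (hadm n).abs_drift_le hlam hγ hM hmb x.2)
      (ae_of_all _ fun x => ?_)
    exact tendsto_const_nhds.congr' ((hev x.2).mono fun n hn => by
      simp only [hn.deriv_eq])
  have t2 : Tendsto (fun n => ∫ x : PosReal, ψ n x ∂Φ) atTop (𝓝 (∫ x : PosReal, φ x ∂Φ)) :=
    tendsto_integral_of_dominated_convergence _
      (fun n => (hadm n).continuous_subtype.measurable.aestronglyMeasurable)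
      (hΦ.integrable_momentWeight.const_mul _)
      (fun n => ae_of_all _ fun x => (hadm n).abs_le_momentWeight hlam hmb x.2)
      (ae_of_all _ fun x => hpt x.2)
  have t3 : Tendsto (fun n => ∫ p : PosReal × PosReal,
        K p.1 p.2 * coagIncrement (ψ n) p.1 p.2 ∂(Φ.prod Φ)) atTop
      (𝓝 (∫ p : PosReal × PosReal, K p.1 p.2 * coagIncrement φ p.1 p.2 ∂(Φ.prod Φ))) :=
    tendsto_integral_of_dominated_convergence _
      (fun n => (hadm n).aestronglyMeasurable_coag hK _)
      ((hΦ.integrable_momentWeight.mul_prod hΦ.integrable_momentWeight).const_mul C)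
      (fun n => ae_of_all _ fun p => hC _ (hadm n) p.1 p.2 p.1.2 p.2.2)
      (ae_of_all _ fun p => tendsto_const_nhds.mul
        (((hpt (add_pos p.1.2 p.2.2)).sub (hpt p.1.2)).sub (hpt p.2.2)))
  refine tendsto_nhds_unique (t1.sub (t2.const_mul _)) ((t3.const_mul (1 / 2)).congr fun n => ?_)
  rw [integral_prod _ ((hadm n).integrable_coag hK hΦ hm)]
  exact (hΦ.weak_eq _ (h.isTestFunction_mul_cutoff (by positivity))).symm

end Integrability

/-! ### The regularised subadditive test function -/

/-- A subadditive approximation of `(1 + x) ^ m` which is linear at the origin. -/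
noncomputable def regStep (ε m x : ℝ) : ℝ := x / (x + ε) * (1 + x) ^ m

section RegStep

variable {ε m x : ℝ}

lemma regStep_nonneg (hε : 0 < ε) (hx : 0 < x) : 0 ≤ regStep ε m x := by
  unfold regStep
  positivity

lemma deriv_regStep (hε : 0 < ε) (hx : 0 < x) :
    deriv (regStep ε m) x =
      ε / (x + ε) ^ 2 * (1 + x) ^ m + m * (regStep ε m x / (1 + x)) := by
  have hxe : x + ε ≠ 0 := by positivity
  have hx1 : 0 < 1 + x := by positivity
  have h1 : HasDerivAt (fun x => x / (x + ε)) ((1 * (x + ε) - x * 1) / (x + ε) ^ 2) x :=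
    (hasDerivAt_id x).div ((hasDerivAt_id x).add_const ε) hxe
  have h2 : HasDerivAt (fun x : ℝ => (1 + x) ^ m) (1 * m * (1 + x) ^ (m - 1)) x :=
    ((hasDerivAt_id x).const_add 1).rpow_const (Or.inl hx1.ne')
  have h3 : deriv (regStep ε m) x = _ := (h1.mul h2).deriv
  rw [h3, Real.rpow_sub_one hx1.ne']
  unfold regStep
  field_simp
  ring

lemma mul_deriv_regStep (hε : 0 < ε) (hx : 0 < x) :
    x * deriv (regStep ε m) x = regStep ε m x * (ε / (x + ε) + m * (x / (1 + x))) := by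
  rw [deriv_regStep hε hx]
  unfold regStep
  field_simp

lemma mul_regStep_le_mul_deriv (hε : 0 < ε) (hm : m ≤ 0) (hx : 0 < x) :
    m * regStep ε m x ≤ x * deriv (regStep ε m) x := by
  rw [mul_deriv_regStep hε hx, mul_comm]
  refine mul_le_mul_of_nonneg_left ?_ (regStep_nonneg hε hx)
  have h1 : x / (1 + x) ≤ 1 := (div_le_one (by positivity)).2 (by linarith)
  have h2 : 0 < ε / (x + ε) := by positivity
  nlinarith

lemma deriv_regStep_le (hε : 0 < ε) (hm : m ≤ 0) (hx : 0 < x) :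
    deriv (regStep ε m) x ≤ ε / (x + ε) ^ 2 := by
  rw [deriv_regStep hε hx]
  have h1 : (1 + x) ^ m ≤ 1 := Real.rpow_le_one_of_one_le_of_nonpos (by linarith) hm
  have h2 : 0 < ε / (x + ε) ^ 2 := by positivity
  have h3 : 0 ≤ regStep ε m x / (1 + x) := div_nonneg (regStep_nonneg hε hx) (by positivity)
  nlinarith

/-- The constant blows up as ε → 0, harmlessly: admissibility is used only at fixed ε. -/
lemma isAdmissible_regStep (hε : 0 < ε) (hε1 : ε ≤ 1) (hm : m ≤ 0) :
    IsAdmissible (regStep ε m) m ((1 - m) / ε) := by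
  have hA : 1 - m ≤ (1 - m) / ε := (le_div_iff₀ hε).2 (by nlinarith)
  have b1 : ∀ x, 0 < x → regStep ε m x ≤ x / ε := fun x hx => by
    have h1 : (1 + x) ^ m ≤ 1 := Real.rpow_le_one_of_one_le_of_nonpos (by linarith) hm
    calc regStep ε m x ≤ x / (x + ε) * 1 := by unfold regStep; gcongr
      _ ≤ x / ε := by rw [mul_one]; gcongr; linarith
  have b2 : ∀ x, 0 < x → regStep ε m x ≤ x ^ m := fun x hx => by
    have h1 : (1 + x) ^ m ≤ x ^ m := Real.rpow_le_rpow_of_nonpos hx (by linarith) hm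
    have h2 : x / (x + ε) ≤ 1 := (div_le_one (by positivity)).2 (by linarith)
    calc regStep ε m x ≤ 1 * x ^ m := by unfold regStep; gcongr
      _ = x ^ m := one_mul _
  have d : ∀ x, 0 < x → |x * deriv (regStep ε m) x| ≤ (1 - m) * regStep ε m x := fun x hx => by
    have h0 := regStep_nonneg (m := m) hε hx
    have h1 : x / (1 + x) ≤ 1 := (div_le_one (by positivity)).2 (by linarith)
    have h1' : 0 < x / (1 + x) := by positivity
    have h2 : ε / (x + ε) ≤ 1 := (div_le_one (by positivity)).2 (by linarith)
    have h2' : 0 < ε / (x + ε) := by positivity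
    rw [mul_deriv_regStep hε hx, abs_mul, abs_of_nonneg h0, mul_comm]
    refine mul_le_mul_of_nonneg_right (abs_le.2 ⟨?_, ?_⟩) h0 <;> nlinarith
  have c1 : ∀ x, 0 < x → (1 - m) * regStep ε m x ≤ (1 - m) / ε * x := fun x hx => by
    calc (1 - m) * regStep ε m x ≤ (1 - m) * (x / ε) :=
          mul_le_mul_of_nonneg_left (b1 x hx) (by linarith)
      _ = _ := by ring
  have c2 : ∀ x, 0 < x → (1 - m) * regStep ε m x ≤ (1 - m) / ε * x ^ m := fun x hx => by
    have := Real.rpow_pos_of_pos hx m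
    exact (mul_le_mul_of_nonneg_left (b2 x hx) (by linarith)).trans (by gcongr)
  have c0 : ∀ x, 0 < x → |regStep ε m x| ≤ (1 - m) * regStep ε m x := fun x hx => by
    have h0 := regStep_nonneg (m := m) hε hx
    rw [abs_of_nonneg h0]
    nlinarith
  refine ⟨?_, fun x hx => (c0 x hx).trans (c1 x hx), fun x hx => (c0 x hx).trans (c2 x hx),
    fun x hx => (d x hx).trans (c1 x hx), fun x hx => (d x hx).trans (c2 x hx)⟩
  intro x hx
  have hx' : 0 < x := hx
  refine ContDiffAt.contDiffWithinAt (ContDiffAt.mul ?_ ?_)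
  · exact contDiffAt_id.div (contDiffAt_id.add contDiffAt_const) (by positivity)
  · exact (contDiffAt_const.add contDiffAt_id).rpow_const_of_ne (by positivity)

/-- Split the value at x+y into its shares proportional to x and y. The y-share is at most the value
at y, and the x-share falls short of the value at x by at least the stated gap. -/
lemma le_neg_coagIncrement_regStep (hε : 0 < ε) (hm : m ≤ 0) {y : ℝ} (hx : 0 < x) (hy : 0 < y) :
    (1 + x) ^ m * (x * y / ((x + ε) * (x + y + ε))) ≤ -coagIncrement (regStep ε m) x y := by
  have hP : (1 + (x + y)) ^ m ≤ (1 + x) ^ m :=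
    Real.rpow_le_rpow_of_nonpos (by linarith) (by linarith) hm
  have hQ : (1 + (x + y)) ^ m ≤ (1 + y) ^ m :=
    Real.rpow_le_rpow_of_nonpos (by linarith) (by linarith) hm
  have h1 : x / (x + y + ε) * (1 + (x + y)) ^ m ≤ x / (x + y + ε) * (1 + x) ^ m := by gcongr
  have h2 : y / (x + y + ε) * (1 + (x + y)) ^ m ≤ y / (y + ε) * (1 + y) ^ m := by
    gcongr
    linarith
  have h3 : (1 + x) ^ m * (x * y / ((x + ε) * (x + y + ε))) =
      x / (x + ε) * (1 + x) ^ m - x / (x + y + ε) * (1 + x) ^ m := by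
    field_simp
    ring
  have h4 : (x + y) / (x + y + ε) * (1 + (x + y)) ^ m =
      x / (x + y + ε) * (1 + (x + y)) ^ m + y / (x + y + ε) * (1 + (x + y)) ^ m := by ring
  unfold coagIncrement regStep
  linarith

end RegStep

/-! ### Loss against flux -/

/-- The small-particle factor in the lower bound for the coagulation rate. -/
noncomputable def lossDensity (lam m ε x : ℝ) : ℝ := x ^ (1 - lam) * (1 + x) ^ (m - 1) / (x + ε)

/-- The density of the flux of particles into the origin at scale `ε`. -/
noncomputable def fluxDensity (b ε x : ℝ) : ℝ := ε / (x + ε) ^ 2 * x ^ b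

lemma lossDensity_pos {lam m ε x : ℝ} (hε : 0 < ε) (hx : 0 < x) : 0 < lossDensity lam m ε x := by
  unfold lossDensity
  positivity

lemma fluxDensity_nonneg {b ε x : ℝ} (hε : 0 < ε) (hx : 0 < x) : 0 ≤ fluxDensity b ε x := by
  unfold fluxDensity
  positivity

section Profile

variable {K : ℝ → ℝ → ℝ} {γ lam : ℝ} {Φ : Measure PosReal}

lemma measurable_fluxDensity (b ε : ℝ) : Measurable (fluxDensity b ε) := by
  unfold fluxDensity
  fun_prop

lemma measurable_lossDensity (lam m ε : ℝ) : Measurable (lossDensity lam m ε) := by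
  unfold lossDensity
  fun_prop

lemma fluxDensity_le {b ε x : ℝ} (hε : 0 < ε) (hx : 0 < x) :
    fluxDensity b ε x ≤ ε⁻¹ * x ^ b := by
  unfold fluxDensity
  gcongr
  rw [div_le_iff₀ (by positivity), inv_mul_eq_div, le_div_iff₀ hε]
  nlinarith

lemma integrable_fluxDensity (hΦ : IsSelfSimilarProfile K γ lam Φ) {ε : ℝ} (hε : 0 < ε) :
    Integrable (fun x : PosReal => fluxDensity (γ + lam) ε x) Φ := by
  refine (hΦ.integrable_rpow.const_mul ε⁻¹).mono'
    ((measurable_fluxDensity _ ε).comp measurable_subtype_coe).aestronglyMeasurable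
    (ae_of_all _ fun x => ?_)
  rw [Real.norm_of_nonneg (fluxDensity_nonneg hε x.2)]
  exact fluxDensity_le hε x.2

lemma lossDensity_le_momentWeight {m ε b x : ℝ} (hb : 0 ≤ b + lam) (hm : m ≤ 0) (hε : 0 < ε)
    (hε1 : ε ≤ 1) (hx : 0 < x) : lossDensity lam m ε x ≤ ε⁻¹ * momentWeight b lam x := by
  have h1 : (1 + x) ^ (m - 1) ≤ 1 :=
    Real.rpow_le_one_of_one_le_of_nonpos (by linarith) (by linarith)
  have h2 : x ^ (1 - lam) = x * x ^ (-lam) := by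
    rw [sub_eq_add_neg, Real.rpow_add hx, Real.rpow_one]
  have h3 : x / (x + ε) ≤ ε⁻¹ * min 1 x := by
    rw [div_le_iff₀ (by positivity), mul_assoc, inv_mul_eq_div, le_div_iff₀ hε]
    rcases le_total x 1 with h | h
    · rw [min_eq_right h]
      nlinarith
    · rw [min_eq_left h]
      nlinarith
  calc lossDensity lam m ε x = x / (x + ε) * x ^ (-lam) * (1 + x) ^ (m - 1) := by
        unfold lossDensity
        rw [h2]
        ring
    _ ≤ ε⁻¹ * min 1 x * x ^ (-lam) * 1 := by gcongr
    _ = ε⁻¹ * (min 1 x * x ^ (-lam)) := by ring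
    _ ≤ _ := by
      gcongr
      exact min_one_mul_rpow_neg_le_momentWeight hb hx

lemma integrable_lossDensity (hΦ : IsSelfSimilarProfile K γ lam Φ) (hs : 0 ≤ γ + 2 * lam)
    {m ε : ℝ} (hm : m ≤ 0) (hε : 0 < ε) (hε1 : ε ≤ 1) :
    Integrable (fun x : PosReal => lossDensity lam m ε x) Φ := by
  refine (hΦ.integrable_momentWeight.const_mul ε⁻¹).mono'
    ((measurable_lossDensity lam m ε).comp measurable_subtype_coe).aestronglyMeasurable
    (ae_of_all _ fun x => ?_)
  rw [Real.norm_of_nonneg (lossDensity_pos hε x.2).le]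
  exact lossDensity_le_momentWeight (by linarith) hm hε hε1 x.2

lemma integrable_rpow_mul_div (hΦ : IsSelfSimilarProfile K γ lam Φ) :
    Integrable (fun y : PosReal => (y : ℝ) ^ (γ + lam) * (y / (1 + y))) Φ := by
  refine hΦ.integrable_rpow.mono' ?_ (ae_of_all _ fun x => ?_)
  · have : Measurable fun y : ℝ => y ^ (γ + lam) * (y / (1 + y)) := by fun_prop
    exact (this.comp measurable_subtype_coe).aestronglyMeasurable
  · have hx : (0 : ℝ) < x := x.2
    rw [Real.norm_of_nonneg (by positivity)]
    exact mul_le_of_le_one_right (by positivity) ((div_le_one (by positivity)).2 (by linarith))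

/-- Only the term y^(γ+λ)/x^λ of the kernel is kept, and x+y+ε ≤ (1+x)(1+y) for ε ≤ 1. This
separates the variables, with a y-factor free of ε. -/
lemma le_neg_mul_coagIncrement_regStep {c₂ m ε x y : ℝ} (hc₂ : 0 < c₂)
    (hb : c₂ * (x ^ (γ + lam) / y ^ lam + y ^ (γ + lam) / x ^ lam) ≤ K x y) (hm : m ≤ 0)
    (hε : 0 < ε) (hε1 : ε ≤ 1) (hx : 0 < x) (hy : 0 < y) :
    c₂ * (lossDensity lam m ε x * (y ^ (γ + lam) * (y / (1 + y)))) ≤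
      -(K x y * coagIncrement (regStep ε m) x y) := by
  have h1 := le_neg_coagIncrement_regStep hε hm hx hy
  have h2 : c₂ * (x ^ (-lam) * y ^ (γ + lam)) ≤ K x y := by
    refine le_trans ?_ hb
    rw [Real.rpow_neg hx.le, ← div_eq_inv_mul]
    gcongr
    have : 0 < x ^ (γ + lam) / y ^ lam := by positivity
    linarith
  have h3 : x ^ (1 - lam) = x * x ^ (-lam) := by
    rw [sub_eq_add_neg, Real.rpow_add hx, Real.rpow_one]
  have h4 : (1 + x) ^ (m - 1) = (1 + x) ^ m / (1 + x) := Real.rpow_sub_one (by positivity) m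
  rw [← mul_neg]
  refine le_trans ?_ (mul_le_mul h2 h1 (by positivity) (le_trans (by positivity) h2))
  unfold lossDensity
  rw [h3, h4]
  calc c₂ * (x * x ^ (-lam) * ((1 + x) ^ m / (1 + x)) / (x + ε) *
        (y ^ (γ + lam) * (y / (1 + y))))
      = c₂ * (x ^ (-lam) * y ^ (γ + lam)) *
        ((1 + x) ^ m * (x * y / ((x + ε) * ((1 + x) * (1 + y))))) := by
        field_simp
    _ ≤ _ := by
        gcongr
        nlinarith

/-- The flux into the origin controls the coagulation loss, uniformly in the scale `ε`. -/
theorem exists_mul_integral_lossDensity_le (hΦ : IsSelfSimilarProfile K γ lam Φ)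
    (hK : IsCoagulationKernel K γ lam) (hγ : γ ≤ -1) (hs : 1 ≤ γ + 2 * lam) :
    ∃ m c : ℝ, m ≤ 0 ∧ 0 < c ∧ ∀ ε : ℝ, 0 < ε → ε ≤ 1 →
      c * ∫ x : PosReal, lossDensity lam m ε x ∂Φ ≤
        ∫ x : PosReal, fluxDensity (γ + lam) ε x ∂Φ := by
  have := hΦ.locallyFinite
  obtain ⟨c₁, c₂, hc₂, -, hb⟩ := hK.bounds
  set m := min (γ + lam) 0 with hmdef
  have hm : m ≤ 0 := min_le_right _ _
  have hmb : m ≤ γ + lam := min_le_left _ _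
  have hmγ : 1 + γ ≤ 2 * m := by
    -- If m = γ+λ this is γ+2λ ≥ 1; if m = 0 it is γ ≤ -1.
    rcases min_choice (γ + lam) 0 with h | h <;> rw [hmdef, h] <;> linarith
  have hγ1 : 0 < 1 - γ := by linarith
  set M := ∫ z : PosReal, (z : ℝ) ^ (γ + lam) ∂Φ with hMdef
  have hM : 0 < M := hΦ.moment_integral_pos
  set G := ∫ y : PosReal, (y : ℝ) ^ (γ + lam) * (y / (1 + y)) ∂Φ with hGdef
  have hG : 0 < G := integral_pos_of_pos hΦ.ne_zero (integrable_rpow_mul_div hΦ) fun y => by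
    have hy : (0 : ℝ) < y := y.2
    positivity
  refine ⟨m, M * (1 / 2 * (c₂ * G)), hm, by positivity, fun ε hε hε1 => ?_⟩
  have hadm := isAdmissible_regStep hε hε1 hm
  have hweak := hΦ.weak_eq_of_isAdmissible hK (by linarith) (by linarith) hm hmb hadm
  rw [← hMdef] at hweak
  have hcoag : c₂ * ((∫ x : PosReal, lossDensity lam m ε x ∂Φ) * G) ≤
      -∫ p : PosReal × PosReal, K p.1 p.2 * coagIncrement (regStep ε m) p.1 p.2 ∂(Φ.prod Φ) := by
    rw [hGdef, ← integral_prod_mul, ← integral_const_mul, ← integral_neg]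
    refine integral_mono (((integrable_lossDensity hΦ (by linarith) hm hε hε1).mul_prod
      (integrable_rpow_mul_div hΦ)).const_mul c₂) (hadm.integrable_coag hK hΦ hm).neg fun p => ?_
    exact le_neg_mul_coagIncrement_regStep hc₂ (hb _ _ p.1.2 p.2.2).1 hm hε hε1 p.1.2 p.2.2
  have hdrift : -(M⁻¹ * ∫ x : PosReal, fluxDensity (γ + lam) ε x ∂Φ) ≤
      (∫ x : PosReal, deriv (regStep ε m) x * driftCoeff γ (γ + lam) M x ∂Φ)
        - (1 + γ) / (1 - γ) * ∫ x : PosReal, regStep ε m x ∂Φ := by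
    have i1 := hadm.integrable_drift hΦ (by linarith) (by linarith : γ < 1) hM hmb
    have i2 := (hadm.integrable hΦ (by linarith) hmb).const_mul ((1 + γ) / (1 - γ))
    rw [← integral_const_mul, ← integral_const_mul, ← integral_neg, ← integral_sub i1 i2]
    refine integral_mono ((integrable_fluxDensity hΦ hε).const_mul _).neg (i1.sub i2) fun x => ?_
    have hx : (0 : ℝ) < x := x.2
    have h1 := mul_regStep_le_mul_deriv hε hm hx
    have h2 := mul_le_mul_of_nonneg_right (deriv_regStep_le hε hm hx)
      (by positivity : 0 ≤ M⁻¹ * (x : ℝ) ^ (γ + lam))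
    have h3 := regStep_nonneg (m := m) hε hx
    -- The bracket is at least (2m - (1+γ)) φ, which `hmγ` makes nonnegative.
    have h4 : 0 ≤ (1 - γ)⁻¹ * (2 * (x * deriv (regStep ε m) x) - (1 + γ) * regStep ε m x) := by
      refine mul_nonneg (by positivity) ?_
      nlinarith
    have h5 : deriv (regStep ε m) x * driftCoeff γ (γ + lam) M x
        - (1 + γ) / (1 - γ) * regStep ε m x =
        (1 - γ)⁻¹ * (2 * (x * deriv (regStep ε m) x) - (1 + γ) * regStep ε m x)
          - deriv (regStep ε m) x * (M⁻¹ * (x : ℝ) ^ (γ + lam)) := by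
      unfold driftCoeff
      ring
    change -(M⁻¹ * (ε / ((x : ℝ) + ε) ^ 2 * (x : ℝ) ^ (γ + lam))) ≤ _
    rw [h5]
    linarith
  rw [hweak] at hdrift
  have h5 : 1 / 2 * (c₂ * ((∫ x : PosReal, lossDensity lam m ε x ∂Φ) * G)) ≤
      M⁻¹ * ∫ x : PosReal, fluxDensity (γ + lam) ε x ∂Φ := by linarith
  rw [inv_mul_eq_div, le_div_iff₀ hM] at h5
  linarith

/-! ### Limit of the flux as ε → 0 -/

lemma lossDensity_anti {m ε x : ℝ} (hε : 0 < ε) (hε1 : ε ≤ 1) (hx : 0 < x) :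
    lossDensity lam m 1 x ≤ lossDensity lam m ε x := by
  unfold lossDensity
  gcongr

/-- The flux into the origin does not vanish as the scale tends to zero. -/
lemma not_tendsto_integral_fluxDensity (hΦ : IsSelfSimilarProfile K γ lam Φ)
    (hs : 0 ≤ γ + 2 * lam) {m c : ℝ} (hm : m ≤ 0) (hc : 0 < c)
    (h : ∀ ε : ℝ, 0 < ε → ε ≤ 1 → c * ∫ x : PosReal, lossDensity lam m ε x ∂Φ ≤
      ∫ x : PosReal, fluxDensity (γ + lam) ε x ∂Φ) {u : ℕ → ℝ} (hu : ∀ n, 0 < u n)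
    (hu1 : ∀ n, u n ≤ 1) :
    ¬ Tendsto (fun n => ∫ x : PosReal, fluxDensity (γ + lam) (u n) x ∂Φ) atTop (𝓝 0) := by
  intro ht
  have hpos : 0 < ∫ x : PosReal, lossDensity lam m 1 x ∂Φ :=
    integral_pos_of_pos hΦ.ne_zero (integrable_lossDensity hΦ hs hm one_pos le_rfl)
      fun x => lossDensity_pos one_pos x.2
  have hle := ge_of_tendsto' ht fun n => (mul_le_mul_of_nonneg_left (integral_mono
    (integrable_lossDensity hΦ hs hm one_pos le_rfl)
    (integrable_lossDensity hΦ hs hm (hu n) (hu1 n))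
    fun x => lossDensity_anti (hu n) (hu1 n) x.2) hc.le).trans (h (u n) (hu n) (hu1 n))
  nlinarith

/-- Flux is at most x^b/(x+ε), and loss exceeds that by the factor x^(1-(b+λ)) (1+x)^(m-1), which
blows up at 0; beyond η the flux is O(ε). The threshold η does not depend on ε. -/
lemma exists_fluxDensity_le {m c b : ℝ} (hs : 1 < b + lam) (hm : m ≤ 0) (hc : 0 < c) :
    ∃ η : ℝ, 0 < η ∧ ∀ ε x : ℝ, 0 < ε → 0 < x →
      fluxDensity b ε x ≤ c / 2 * lossDensity lam m ε x + ε * ((η ^ 2)⁻¹ * x ^ b) := by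
  have hlim : Tendsto (fun x : ℝ => x ^ (1 - (b + lam))) (𝓝[>] 0) atTop :=
    tendsto_rpow_neg_nhdsGT_zero (by linarith)
  -- Keeping x ≤ 1 gives (1+x)^(m-1) ≥ 2^(m-1), whence the threshold for the blow-up.
  obtain ⟨η, hη, hηle⟩ := (mem_nhdsGT_iff_exists_Ioc_subset).1
    ((hlim.eventually_ge_atTop (2 / (c * 2 ^ (m - 1)))).and
      (Ioc_mem_nhdsGT (zero_lt_one' ℝ)))
  refine ⟨η, hη, fun ε x hε hx => ?_⟩
  have hη' : 0 < η := hη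
  rcases le_or_gt x η with h | h
  · obtain ⟨h1, h2⟩ := hηle ⟨hx, h⟩
    have h1 : 2 / (c * 2 ^ (m - 1)) ≤ x ^ (1 - (b + lam)) := h1
    have h3 : (2 : ℝ) ^ (m - 1) ≤ (1 + x) ^ (m - 1) :=
      Real.rpow_le_rpow_of_nonpos (by linarith) (by linarith [h2.2]) (by linarith)
    have h4 : x ^ (1 - lam) = x ^ (1 - (b + lam)) * x ^ b := by
      rw [← Real.rpow_add hx]
      congr 1
      ring
    rw [div_le_iff₀ (by positivity)] at h1
    have h5 : 1 ≤ c / 2 * (x ^ (1 - (b + lam)) * (1 + x) ^ (m - 1)) := by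
      have : x ^ (1 - (b + lam)) * 2 ^ (m - 1) ≤ x ^ (1 - (b + lam)) * (1 + x) ^ (m - 1) := by
        gcongr
      nlinarith
    have h6 : fluxDensity b ε x ≤ x ^ b / (x + ε) := by
      unfold fluxDensity
      rw [div_mul_eq_mul_div, div_le_div_iff₀ (by positivity) (by positivity)]
      have : 0 < x ^ b * (x + ε) := by positivity
      nlinarith
    have h7 : x ^ b / (x + ε) ≤ c / 2 * lossDensity lam m ε x := by
      unfold lossDensity
      rw [h4]
      have : 0 < x ^ b / (x + ε) := by positivity
      calc x ^ b / (x + ε) ≤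
            c / 2 * (x ^ (1 - (b + lam)) * (1 + x) ^ (m - 1)) * (x ^ b / (x + ε)) :=
            le_mul_of_one_le_left this.le h5
        _ = _ := by ring
    have h8 : 0 ≤ ε * ((η ^ 2)⁻¹ * x ^ b) := by positivity
    linarith
  · have h1 := lossDensity_pos (lam := lam) (m := m) hε hx
    have h2 : fluxDensity b ε x ≤ ε * ((η ^ 2)⁻¹ * x ^ b) := by
      unfold fluxDensity
      rw [div_eq_mul_inv, mul_assoc]
      gcongr
      linarith
    nlinarith

lemma tendsto_integral_fluxDensity_of_one_lt (hΦ : IsSelfSimilarProfile K γ lam Φ)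
    (hs : 1 < γ + 2 * lam) {m c : ℝ} (hm : m ≤ 0) (hc : 0 < c)
    (h : ∀ ε : ℝ, 0 < ε → ε ≤ 1 → c * ∫ x : PosReal, lossDensity lam m ε x ∂Φ ≤
      ∫ x : PosReal, fluxDensity (γ + lam) ε x ∂Φ) {u : ℕ → ℝ} (hu : ∀ n, 0 < u n)
    (hu1 : ∀ n, u n ≤ 1) (hu0 : Tendsto u atTop (𝓝 0)) :
    Tendsto (fun n => ∫ x : PosReal, fluxDensity (γ + lam) (u n) x ∂Φ) atTop (𝓝 0) := by
  obtain ⟨η, hη, hle⟩ := exists_fluxDensity_le (lam := lam) (b := γ + lam) (by linarith) hm hc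
  have hlim : Tendsto
      (fun n => u n * (2 * ∫ x : PosReal, (η ^ 2)⁻¹ * (x : ℝ) ^ (γ + lam) ∂Φ)) atTop (𝓝 0) := by
    simpa using hu0.mul_const (2 * ∫ x : PosReal, (η ^ 2)⁻¹ * (x : ℝ) ^ (γ + lam) ∂Φ)
  refine squeeze_zero (fun n => integral_nonneg fun x => fluxDensity_nonneg (hu n) x.2)
    (fun n => ?_) hlim
  have i1 := (integrable_lossDensity hΦ (by linarith) hm (hu n) (hu1 n)).const_mul (c / 2)
  have i2 := (hΦ.integrable_rpow.const_mul (η ^ 2)⁻¹).const_mul (u n)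
  have h1 := integral_mono (integrable_fluxDensity hΦ (hu n)) (i1.add i2)
    fun x => hle (u n) x (hu n) x.2
  have h2 := h (u n) (hu n) (hu1 n)
  simp only [Pi.add_apply] at h1
  -- By `h2` the loss term is at most half the flux and moves to the left, which produces the factor
  -- 2 in `hlim`.
  rw [integral_add i1 i2, integral_const_mul, integral_const_mul] at h1
  linarith

/-- At the critical exponent x^(γ+λ)/x = x^(-λ), and ε/(x+ε)² ≤ 1/x, so the extra moment is exactly
the majorant needed near 0. -/
lemma tendsto_integral_fluxDensity_of_eq_one (hΦ : IsSelfSimilarProfile K γ lam Φ)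
    (hs : γ + 2 * lam = 1)
    (h : ∫⁻ x in {x : PosReal | (x : ℝ) ≤ 1}, ENNReal.ofReal ((x : ℝ) ^ (-lam)) ∂Φ < ⊤)
    {u : ℕ → ℝ} (hu : ∀ n, 0 < u n) (hu1 : ∀ n, u n ≤ 1) (hu0 : Tendsto u atTop (𝓝 0)) :
    Tendsto (fun n => ∫ x : PosReal, fluxDensity (γ + lam) (u n) x ∂Φ) atTop (𝓝 0) := by
  have hint := integrable_ite_rpow (p := fun x => x ≤ 1)
    (measurableSet_le measurable_subtype_coe measurable_const) h
  suffices H : Tendsto (fun n => ∫ x : PosReal, fluxDensity (γ + lam) (u n) x ∂Φ) atTop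
      (𝓝 (∫ _ : PosReal, (0 : ℝ) ∂Φ)) by simpa using H
  refine tendsto_integral_of_dominated_convergence _
    (fun n => (integrable_fluxDensity hΦ (hu n)).aestronglyMeasurable)
    (hint.add hΦ.integrable_rpow) (fun n => ae_of_all _ fun x => ?_) (ae_of_all _ fun x => ?_)
  · have hx : (0 : ℝ) < x := x.2
    have hr := Real.rpow_pos_of_pos hx (γ + lam)
    have hn := hu n
    rw [Real.norm_of_nonneg (fluxDensity_nonneg hn hx)]
    simp only [Pi.add_apply, fluxDensity]
    split_ifs with h1
    · have e1 : (x : ℝ) ^ (-lam) = (x : ℝ)⁻¹ * (x : ℝ) ^ (γ + lam) := by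
        rw [← Real.rpow_neg_one, ← Real.rpow_add hx]
        congr 1
        linarith
      have e2 : u n / ((x : ℝ) + u n) ^ 2 ≤ (x : ℝ)⁻¹ := by
        rw [← one_div, div_le_div_iff₀ (by positivity) hx]
        nlinarith
      rw [e1]
      nlinarith
    · have e2 : u n / ((x : ℝ) + u n) ^ 2 ≤ 1 := by
        rw [div_le_one (by positivity)]
        nlinarith [hu1 n]
      nlinarith
  · have hx : (0 : ℝ) < x := x.2
    have ht : Tendsto (fun n => u n / ((x : ℝ) + u n) ^ 2 * (x : ℝ) ^ (γ + lam)) atTop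
        (𝓝 (0 / ((x : ℝ) + 0) ^ 2 * (x : ℝ) ^ (γ + lam))) :=
      (hu0.div ((hu0.const_add _).pow 2) (by positivity)).mul_const _
    simpa [fluxDensity] using ht

end Profile

/-! ### Nonexistence, along the scales ε = 1/(n+1) -/

theorem theorem3p3 (K : ℝ → ℝ → ℝ) (γ lam : ℝ) (hK : IsCoagulationKernel K γ lam)
    (hγ : γ < 1) (hγlam : γ + lam < 1) :
    (γ ≤ -1 → 1 < γ + 2 * lam →
      ¬ ∃ Φ : Measure PosReal, IsSelfSimilarProfile K γ lam Φ) ∧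
    (γ ≤ -1 → γ + 2 * lam = 1 →
      ¬ ∃ Φ : Measure PosReal, IsSelfSimilarProfile K γ lam Φ ∧
        ∫⁻ x in {x : PosReal | (x : ℝ) ≤ 1}, ENNReal.ofReal ((x : ℝ) ^ (-lam)) ∂Φ < ⊤) := by
  have hu : ∀ n : ℕ, 0 < 1 / ((n : ℝ) + 1) := fun n => by positivity
  have hu1 : ∀ n : ℕ, 1 / ((n : ℝ) + 1) ≤ 1 := fun n =>
    (div_le_one (by positivity)).2 (by linarith [n.cast_nonneg (α := ℝ)])
  have hu0 := tendsto_one_div_add_atTop_nhds_zero_nat (𝕜 := ℝ)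
  constructor
  · rintro hγ' hs ⟨Φ, hΦ⟩
    obtain ⟨m, c, hm, hc, h⟩ := exists_mul_integral_lossDensity_le hΦ hK hγ' hs.le
    exact not_tendsto_integral_fluxDensity hΦ (by linarith) hm hc h hu hu1
      (tendsto_integral_fluxDensity_of_one_lt hΦ hs hm hc h hu hu1 hu0)
  · rintro hγ' hs ⟨Φ, hΦ, hint⟩
    obtain ⟨m, c, hm, hc, h⟩ := exists_mul_integral_lossDensity_le hΦ hK hγ' hs.ge
    exact not_tendsto_integral_fluxDensity hΦ (by linarith) hm hc h hu hu1
      (tendsto_integral_fluxDensity_of_eq_one hΦ hs hint hu hu1 hu0)
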